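/- For each sample size $T$ let $y_t=y_{t}^{(T)}$, $0\le t\le T$, be generated by \[ y_t=\begin{cases} c_0T^{-\eta_0}+y_{t-1}+\varepsilon_t, & 1\le t\le k_e,\\ \phi_a y_{t-1}+\varepsilon_t, & k_e+1\le t\le k_c,\\ \phi_b y_{t-1}+\varepsilon_t, & k_c+1\le t\le k_r,\\ c_1T^{-\eta_1}+y_{t-1}+\varepsilon_t, & k_r+1\le t\le T, \end{cases} \] where $y_0=y_0^{(T)}$ is a random variable with $y_0=o_p(T^{1/2})$, $\phi_a=1+c_a/T^a$, $\phi_b=1-c_b/T^b$, and $c_0,c_1\ge 0$, $\eta_0,\eta_1>1/2$, $c_a,c_b>0$, $a,b\in(0,1)$ are constants not depending on $T$. The integer break dates $k_e,k_c,k_r$ depend on $T$ and satisfy $k_e/T\to\tau_e$, $k_c/T\to\tau_c$, $k_r/T\to\tau_r$ as $T\to\infty$, where $0<\tau_e<\tau_c<\tau_r<1$ are fixed. The errors are $\varepsilon_t=\omega(t/T)e_t$, where $e_1,e_2,\dots$ are i.i.d. with $E[e_t]=0$, $E[e_t^2]=1$, $E[e_t^4]<\infty$, and $\omega$ is a nonrandom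 function on $[0,1]$ with $0<\underline\omega<\omega(s)<\overline\omega<\infty$ for all $s\in[0,1]$ and some constants $\underline\omega,\overline\omega$. For $1\le k\le T-1$ put \[ SSR(k)=\sum_{t=1}^{k}\bigl(y_t-\hat\phi_{a}(k)\,y_{t-1}\bigr)^2+\sum_{t=k+1}^{T}\bigl(y_t-\hat\phi_{b}(k)\,y_{t-1}\bigr)^2, \] \[ \hat\phi_a(k)=\frac{\sum_{t=1}^{k}y_{t-1}y_t}{\sum_{t=1}^{k}y_{t-1}^2},\qquad \hat\phi_b(k)=\frac{\sum_{t=k+1}^{T}y_{t-1}y_t}{\sum_{t=k+1}^{T}y_{t-1}^2} \] (if a denominator vanishes, the corresponding coefficient may be given any value, as the residuals do not depend on it). Let $\hat k=\hat k_T$ be any minimizer of $SSR(k)$ over $1\le k\le T-1$. Then \[ \lim_{T\to\infty}P(\hat k=k_c)=1 . \] -/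

import Mathlib

open MeasureTheory ProbabilityTheory Filter Topology

noncomputable section

/-- The sample path of the four-regime bubble model with sample size `T`, break dates
`kₑ`, `k_c`, `k_r`, initial value `y₀` and errors `ε 1, ε 2, …`: a unit root with drift
`c₀ T ^ (-η₀)` up to `kₑ`, autoregressive coefficient `1 + cₐ / T ^ a` up to `k_c`,
coefficient `1 - c_b / T ^ b` up to `k_r`, and a unit root with drift `c₁ T ^ (-η₁)` afterwards. -/
def bubblePath (c₀ η₀ cₐ a c_b b c₁ η₁ : ℝ) (T kₑ k_c k_r : ℕ) (y₀ : ℝ) (ε : ℕ → ℝ) : ℕ → ℝ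
  | 0 => y₀
  | t + 1 =>
    let y := bubblePath c₀ η₀ cₐ a c_b b c₁ η₁ T kₑ k_c k_r y₀ ε t
    if t + 1 ≤ kₑ then c₀ * (T : ℝ) ^ (-η₀) + y + ε (t + 1)
    else if t + 1 ≤ k_c then (1 + cₐ / (T : ℝ) ^ a) * y + ε (t + 1)
    else if t + 1 ≤ k_r then (1 - c_b / (T : ℝ) ^ b) * y + ε (t + 1)
    else c₁ * (T : ℝ) ^ (-η₁) + y + ε (t + 1)

/-- Least squares estimate of the AR(1) coefficient from the observations `t = l, …, m`
(used with `1 ≤ l`). If the denominator vanishes, then `y (t - 1) = 0` for all these `t`,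
and the residuals below do not depend on the value given to the estimate. -/
def arCoeff (y : ℕ → ℝ) (l m : ℕ) : ℝ :=
  (∑ t ∈ Finset.Icc l m, y (t - 1) * y t) / ∑ t ∈ Finset.Icc l m, y (t - 1) ^ 2

/-- Sum of squared residuals of the AR(1) fit to the observations `t = l, …, m`. -/
def segmentSSR (y : ℕ → ℝ) (l m : ℕ) : ℝ :=
  ∑ t ∈ Finset.Icc l m, (y t - arCoeff y l m * y (t - 1)) ^ 2

/-- Total sum of squared residuals of the two-regime AR(1) fit with break date `k`. -/
def totalSSR (y : ℕ → ℝ) (T k : ℕ) : ℝ :=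
  segmentSSR y 1 k + segmentSSR y (k + 1) T

/-- `k` minimizes the total sum of squared residuals over the dates `1, …, T - 1`. -/
def IsBreakDateEstimate (y : ℕ → ℝ) (T k : ℕ) : Prop :=
  k ∈ Finset.Icc 1 (T - 1) ∧ ∀ j ∈ Finset.Icc 1 (T - 1), totalSSR y T k ≤ totalSSR y T j

end

/-! The peak of the bubble dwarfs everything else. Write `p` and `q` for the explosive and the
collapsing coefficient. At `k_c` the path equals `p ^ (k_c - kₑ)` times the sum of the initial
value, the accumulated drift and a discounted sum of shocks, and this power outgrows every power of
`T`. Splitting at `k_c` and fitting `p` and `q` leaves residuals of polynomial size plus what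
survives of the peak at `k_r`, a fraction smaller than every inverse power of `T`. Any other date
puts the observations `k_c` and `k_c + 1` into one segment. No single coefficient fits both, and a
residual of order `(1 - q) * |y k_c|` remains. Hence only `k_c` can be a minimizer
(`eq_break_of_isBreakDateEstimate`).

Probability enters only to exclude bad paths. The discounted sum must not cancel: by
`exists_measureReal_abs_sum_le_sqrt_le` it falls below `δ * √T` with small probability, because a
Gaussian average of its characteristic function is small. The initial value and the drift are of
smaller order than `√T` and cannot undo this. Markov's inequality bounds the total size of the
shocks by a multiple of `T ^ 2`. No limit theory for the estimated coefficients is needed. -/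

/-! ### Anti-concentration and total size of sums of innovations -/

/-- The indicator of `|x| ≤ s` is at most `exp (1 / 2) * exp (-(x / s) ^ 2 / 2)`. The last factor is
a Gaussian characteristic function, so Fubini moves the transform onto `ν`. -/
theorem measureReal_abs_le_le_integral_norm_charFun (ν : Measure ℝ) [IsProbabilityMeasure ν]
    {s : ℝ} (hs : 0 < s) :
    ν.real {x | |x| ≤ s} ≤ Real.exp (1 / 2) * ∫ g, ‖charFun ν (g / s)‖ ∂gaussianReal 0 1 := by
  have hgauss : ∀ x : ℝ, charFun (gaussianReal 0 1) (x / s) =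
      ((Real.exp (-(x / s) ^ 2 / 2) : ℝ) : ℂ) := by
    intro x
    rw [charFun_gaussianReal]
    push_cast
    congr 1
    simp
    ring
  have hint : Integrable (fun x : ℝ => Real.exp (-(x / s) ^ 2 / 2)) ν := by
    refine Integrable.of_bound (C := 1) (by fun_prop) (ae_of_all _ fun x => ?_)
    rw [Real.norm_eq_abs, Real.abs_exp, Real.exp_le_one_iff]
    nlinarith [sq_nonneg (x / s)]
  have hparseval : ((∫ x, Real.exp (-(x / s) ^ 2 / 2) ∂ν : ℝ) : ℂ) =
      ∫ g, charFun ν (g / s) ∂gaussianReal 0 1 := by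
    rw [← integral_complex_ofReal]
    simp_rw [← hgauss, charFun_apply_real]
    rw [integral_integral_swap]
    · refine integral_congr_ae (ae_of_all _ fun g => integral_congr_ae (ae_of_all _ fun x => ?_))
      simp only
      congr 1
      push_cast
      ring
    · refine Integrable.of_bound (C := 1) (by fun_prop) (ae_of_all _ fun p => ?_)
      simp only [Function.uncurry]
      rw [← Complex.ofReal_mul, Complex.norm_exp_ofReal_mul_I]
  have h1 : ν.real {x | |x| ≤ s} ≤ Real.exp (1 / 2) * ∫ x, Real.exp (-(x / s) ^ 2 / 2) ∂ν := by
    have hms : MeasurableSet {x : ℝ | |x| ≤ s} := measurableSet_le (by fun_prop) (by fun_prop)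
    rw [← integral_indicator_one hms, ← integral_const_mul]
    refine integral_mono ((integrable_const 1).indicator hms) (hint.const_mul _) fun x => ?_
    by_cases hx : x ∈ {x : ℝ | |x| ≤ s}
    · simp only [Set.indicator_of_mem hx, Pi.one_apply, ← Real.exp_add]
      rw [Real.one_le_exp_iff]
      have : (x / s) ^ 2 ≤ 1 := by
        rw [sq_le_one_iff_abs_le_one, abs_div, abs_of_pos hs]
        exact (div_le_one hs).2 hx
      linarith
    · simp only [Set.indicator_of_notMem hx]
      positivity
  refine h1.trans (mul_le_mul_of_nonneg_left ?_ (Real.exp_nonneg _))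
  calc ∫ x, Real.exp (-(x / s) ^ 2 / 2) ∂ν
      ≤ ‖((∫ x, Real.exp (-(x / s) ^ 2 / 2) ∂ν : ℝ) : ℂ)‖ := by
        rw [Complex.norm_real]; exact le_abs_self _
    _ = ‖∫ g, charFun ν (g / s) ∂gaussianReal 0 1‖ := by rw [hparseval]
    _ ≤ _ := norm_integral_le_integral_norm _

theorem exists_norm_charFun_le_exp {Ω : Type*} [MeasurableSpace Ω] {μ : Measure Ω}
    [IsProbabilityMeasure μ] {X : Ω → ℝ} (hX : AEMeasurable X μ)
    (h0 : ∫ x, X x ∂μ = 0) (h1 : ∫ x, X x ^ 2 ∂μ = 1) :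
    ∃ r > 0, ∀ u : ℝ, |u| ≤ r → ‖charFun (μ.map X) u‖ ≤ Real.exp (-(u ^ 2 / 4)) := by
  have ht := (taylor_charFun_two hX h0 (by simpa using h1)).bound (c := 1 / 4) (by norm_num)
  obtain ⟨r, hr, hball⟩ := Metric.eventually_nhds_iff.1 ht
  refine ⟨min (r / 2) 1, by positivity, fun u hu => ?_⟩
  have hur : |u| ≤ r / 2 := hu.trans (min_le_left _ _)
  have hu1 : u ^ 2 ≤ 1 := (sq_le_one_iff_abs_le_one u).2 (hu.trans (min_le_right _ _))
  have hb := hball (y := u) (by rw [Real.dist_eq, sub_zero]; linarith)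
  have hn : ‖((1 : ℂ) - (u : ℂ) ^ 2 / 2)‖ = 1 - u ^ 2 / 2 := by
    have : ((1 : ℂ) - (u : ℂ) ^ 2 / 2) = ((1 - u ^ 2 / 2 : ℝ) : ℂ) := by push_cast; ring
    rw [this, Complex.norm_real, Real.norm_of_nonneg (by linarith)]
  have hu2 : ‖(u : ℝ) ^ 2‖ = u ^ 2 := Real.norm_of_nonneg (sq_nonneg u)
  have htri := norm_add_le (charFun (μ.map X) u - (1 - (u : ℂ) ^ 2 / 2)) (1 - (u : ℂ) ^ 2 / 2)
  rw [sub_add_cancel, hn] at htri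
  rw [hu2] at hb
  have := Real.add_one_le_exp (-(u ^ 2 / 4))
  linarith

/-- Only the first `n` factors are used and the others are bounded by 1. Thus the weights after the
first break may decay geometrically. -/
theorem norm_charFun_map_sum_le {Ω : Type*} [MeasurableSpace Ω] {μ : Measure Ω}
    [IsProbabilityMeasure μ] {X : ℕ → Ω → ℝ} (hindep : iIndepFun X μ)
    (hident : ∀ i, IdentDistrib (X i) (X 0) μ μ) {r : ℝ}
    (hr : ∀ u : ℝ, |u| ≤ r → ‖charFun (μ.map (X 0)) u‖ ≤ Real.exp (-(u ^ 2 / 4)))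
    {lo hi : ℝ} (hlo : 0 < lo) {n N : ℕ} (hnN : n ≤ N) {v : ℕ → ℝ}
    (hv : ∀ i < n, lo ≤ v i ∧ v i ≤ hi) {u : ℝ} (hu : hi * |u| ≤ r) :
    ‖charFun (μ.map (fun x => ∑ i ∈ Finset.range N, v i * X i x)) u‖ ≤
      Real.exp (-(n * (lo * u) ^ 2 / 4)) := by
  have hm : ∀ i, AEMeasurable (X i) μ := fun i => (hident i).aemeasurable_fst
  have hprob : ∀ i, IsProbabilityMeasure (μ.map (X i)) := fun i =>
    Measure.isProbabilityMeasure_map (hm i)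
  have hind : iIndepFun (fun i x => v i * X i x) μ :=
    hindep.comp (fun i z => v i * z) (fun i => by fun_prop)
  rw [(hind.restrict _).charFun_map_fun_finsetSum_eq_prod (fun i _ => (hm i).const_mul _),
    Finset.prod_apply, norm_prod]
  have hfac : ∀ i, charFun (μ.map (fun x => v i * X i x)) u = charFun (μ.map (X 0)) (v i * u) := by
    intro i
    rw [charFun_map_mul_comp (hm i), (hident i).map_eq]
  simp_rw [hfac]
  calc ∏ i ∈ Finset.range N, ‖charFun (μ.map (X 0)) (v i * u)‖
      ≤ ∏ i ∈ Finset.range n, ‖charFun (μ.map (X 0)) (v i * u)‖ := by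
        rw [← Finset.prod_range_mul_prod_Ico _ hnN]
        exact mul_le_of_le_one_right (Finset.prod_nonneg fun _ _ => norm_nonneg _)
          (Finset.prod_le_one (fun _ _ => norm_nonneg _) fun _ _ => norm_charFun_le_one _)
    _ ≤ ∏ i ∈ Finset.range n, Real.exp (-((lo * u) ^ 2 / 4)) := by
        refine Finset.prod_le_prod (fun _ _ => norm_nonneg _) fun i hi' => ?_
        obtain ⟨h1, h2⟩ := hv i (Finset.mem_range.1 hi')
        refine (hr _ ?_).trans (Real.exp_le_exp.2 ?_)
        · rw [abs_mul, abs_of_pos (hlo.trans_le h1)]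
          exact (mul_le_mul_of_nonneg_right h2 (abs_nonneg u)).trans hu
        · have : lo ^ 2 ≤ v i ^ 2 := pow_le_pow_left₀ hlo.le h1 2
          have := mul_le_mul_of_nonneg_right this (sq_nonneg u)
          rw [mul_pow, mul_pow]
          linarith
    _ = Real.exp (-(n * (lo * u) ^ 2 / 4)) := by
        rw [Finset.prod_const, Finset.card_range, ← Real.exp_nat_mul]
        congr 1
        ring

/-- Dominated convergence: the integrand vanishes in the limit for `g ≠ 0`, and the Gaussian has no
atom at 0. -/
theorem tendsto_integral_exp_neg_mul_div_sq_gaussianReal {c : ℝ} (hc : 0 < c) :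
    Tendsto (fun δ : ℝ => ∫ g, Real.exp (-(c * (g / δ) ^ 2)) ∂gaussianReal 0 1) (𝓝[>] 0) (𝓝 0) := by
  have hna : NullSingletonClass (gaussianReal 0 1) :=
    nullSingletonClass_gaussianReal one_ne_zero
  suffices h : Tendsto (fun δ : ℝ => ∫ g, Real.exp (-(c * (g / δ) ^ 2)) ∂gaussianReal 0 1) (𝓝[>] 0)
      (𝓝 (∫ _, (0 : ℝ) ∂gaussianReal 0 1)) by simpa using h
  refine tendsto_integral_filter_of_dominated_convergence (fun _ => 1)
    (Eventually.of_forall fun δ => by fun_prop)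
    (Eventually.of_forall fun δ => ae_of_all _ fun g => ?_)
    (integrable_const 1) ?_
  · rw [Real.norm_eq_abs, Real.abs_exp, Real.exp_le_one_iff]
    have := sq_nonneg (g / δ)
    nlinarith
  · have h0 : ∀ᵐ g ∂gaussianReal 0 1, g ≠ 0 := by
      simp [ae_iff]
    filter_upwards [h0] with g hg
    refine Real.tendsto_exp_atBot.comp (tendsto_neg_atTop_atBot.comp ?_)
    have h1 : Tendsto (fun δ : ℝ => (δ⁻¹) ^ 2) (𝓝[>] 0) atTop :=
      (tendsto_pow_atTop two_ne_zero).comp tendsto_inv_nhdsGT_zero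
    have h2 := h1.const_mul_atTop (show 0 < c * g ^ 2 by positivity)
    refine h2.congr fun δ => ?_
    rw [div_eq_mul_inv, mul_pow, mul_assoc]

/-- At frequency `g / (δ * √T)` the quadratic bound gives `exp (-(c * (g / δ) ^ 2))`, free of `T`
and of the weights, with small Gaussian average for small `δ`. It fails only for `|g|` of order `√T`
or more, which the Gaussian second moment makes negligible. -/
theorem exists_measureReal_abs_sum_le_sqrt_le {Ω : Type*} [MeasurableSpace Ω] {μ : Measure Ω}
    [IsProbabilityMeasure μ] {X : ℕ → Ω → ℝ} (hindep : iIndepFun X μ)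
    (hident : ∀ i, IdentDistrib (X i) (X 0) μ μ)
    (h0 : ∫ x, X 0 x ∂μ = 0) (h1 : ∫ x, X 0 x ^ 2 ∂μ = 1)
    {lo hi κ η : ℝ} (hlo : 0 < lo) (hhi : 0 < hi) (hκ : 0 < κ) (hη : 0 < η) :
    ∃ δ > 0, ∀ᶠ T : ℕ in atTop, ∀ (n N : ℕ) (v : ℕ → ℝ), κ * T ≤ n → n ≤ N →
      (∀ i < n, lo ≤ v i ∧ v i ≤ hi) →
      μ.real {x | |∑ i ∈ Finset.range N, v i * X i x| ≤ δ * √T} ≤ η := by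
  have hm : ∀ i, AEMeasurable (X i) μ := fun i => (hident i).aemeasurable_fst
  obtain ⟨r, hr, hchar⟩ := exists_norm_charFun_le_exp (hm 0) h0 h1
  set c := κ * lo ^ 2 / 4 with hc
  set A := Real.exp (1 / 2) with hA
  have hApos : 0 < A := Real.exp_pos _
  have hcpos : 0 < c := by positivity
  obtain ⟨δ, hδ, hδpos⟩ := (((tendsto_integral_exp_neg_mul_div_sq_gaussianReal hcpos).eventually
    (gt_mem_nhds (show 0 < η / (2 * A) by positivity))).and self_mem_nhdsWithin).exists
  have hδpos : 0 < δ := hδpos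
  refine ⟨δ, hδpos, ?_⟩
  set D := (hi / (r * δ)) ^ 2 with hD
  have hlim : Tendsto (fun T : ℕ => D / T) atTop (𝓝 0) := tendsto_const_div_atTop_nhds_zero_nat D
  filter_upwards [hlim.eventually (gt_mem_nhds (show 0 < η / (2 * A) by positivity)),
    eventually_gt_atTop 0] with T hDT hT n N v hn hnN hv
  have hTpos : (0 : ℝ) < T := by exact_mod_cast hT
  have hsqrt : 0 < √(T : ℝ) := Real.sqrt_pos.2 hTpos
  have hsq : √(T : ℝ) ^ 2 = T := Real.sq_sqrt hTpos.le
  set S : Ω → ℝ := fun x => ∑ i ∈ Finset.range N, v i * X i x with hS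
  have hSm : AEMeasurable S μ := Finset.aemeasurable_fun_sum _ fun i _ => (hm i).const_mul _
  have hprob : IsProbabilityMeasure (μ.map S) := Measure.isProbabilityMeasure_map hSm
  have hmap : μ.real {x | |S x| ≤ δ * √T} = (μ.map S).real {z | |z| ≤ δ * √T} := by
    rw [measureReal_def, measureReal_def, Measure.map_apply_of_aemeasurable hSm
      (measurableSet_le (by fun_prop) (by fun_prop))]
    rfl
  rw [hmap]
  refine (measureReal_abs_le_le_integral_norm_charFun _ (by positivity)).trans ?_
  have hsqint : Integrable (fun g : ℝ => g ^ 2) (gaussianReal 0 1) :=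
    (memLp_id_gaussianReal 2).integrable_sq
  have hsqval : ∫ g, g ^ 2 ∂gaussianReal 0 1 = 1 := by
    have := variance_id_gaussianReal (μ := 0) (v := 1)
    rw [variance_of_integral_eq_zero (by fun_prop) (by simp)] at this
    simpa using this
  have hexpint : Integrable (fun g : ℝ => Real.exp (-(c * (g / δ) ^ 2))) (gaussianReal 0 1) := by
    refine Integrable.of_bound (C := 1) (by fun_prop) (ae_of_all _ fun g => ?_)
    rw [Real.norm_eq_abs, Real.abs_exp, Real.exp_le_one_iff]
    have := sq_nonneg (g / δ)
    nlinarith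
  have hbound : ∀ g : ℝ, ‖charFun (μ.map S) (g / (δ * √T))‖ ≤
      Real.exp (-(c * (g / δ) ^ 2)) + D / T * g ^ 2 := by
    intro g
    by_cases hg : hi * |g / (δ * √T)| ≤ r
    · have h := norm_charFun_map_sum_le hindep hident hchar hlo hnN hv hg
      refine (h.trans (Real.exp_le_exp.2 (neg_le_neg ?_))).trans
        (le_add_of_nonneg_right (by positivity))
      have : c * (g / δ) ^ 2 = κ * T * (lo * (g / (δ * √T))) ^ 2 / 4 := by
        rw [div_pow, mul_pow lo, div_pow g, mul_pow δ, hsq, hc]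
        field_simp
      rw [this]
      gcongr
    -- Outside the Taylor range `hi * |u| / r > 1`, so the trivial bound 1 is at most the square of
    -- this ratio, which is `D / T * g ^ 2`.
    · refine (norm_charFun_le_one _).trans (le_add_of_nonneg_of_le (Real.exp_nonneg _) ?_)
      have h2 : D / T * g ^ 2 = (hi * |g / (δ * √T)| / r) ^ 2 := by
        rw [div_pow, mul_pow, sq_abs, div_pow, mul_pow, hsq, hD]
        field_simp
      rw [h2]
      refine one_le_pow₀ ((one_le_div hr).2 (not_le.1 hg).le)
  have hint : ∫ g, ‖charFun (μ.map S) (g / (δ * √T))‖ ∂gaussianReal 0 1 ≤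
      ∫ g, (Real.exp (-(c * (g / δ) ^ 2)) + D / T * g ^ 2) ∂gaussianReal 0 1 :=
    integral_mono_of_nonneg (ae_of_all _ fun _ => norm_nonneg _)
      (hexpint.add (hsqint.const_mul _)) (ae_of_all _ hbound)
  rw [integral_add hexpint (hsqint.const_mul _), integral_const_mul, hsqval, mul_one] at hint
  calc A * ∫ g, ‖charFun (μ.map S) (g / (δ * √T))‖ ∂gaussianReal 0 1
      ≤ A * (η / (2 * A) + η / (2 * A)) := by gcongr; linarith
    _ = η := by field_simp; norm_num

theorem measureReal_sq_le_sum_abs_le {Ω : Type*} [MeasurableSpace Ω] {μ : Measure Ω}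
    [IsProbabilityMeasure μ] {X : ℕ → Ω → ℝ} (hident : ∀ i, IdentDistrib (X i) (X 0) μ μ)
    (hint : Integrable (X 0) μ) {T : ℕ} (hT : 0 < T) :
    μ.real {x | (T : ℝ) ^ 2 ≤ ∑ i ∈ Finset.range T, |X i x|} ≤ (∫ x, |X 0 x| ∂μ) / T := by
  have hTpos : (0 : ℝ) < T := by exact_mod_cast hT
  have hi : ∀ i, Integrable (X i) μ := fun i => (hident i).integrable_iff.2 hint
  have hmarkov := mul_meas_ge_le_integral_of_nonneg (μ := μ)
    (f := fun x => ∑ i ∈ Finset.range T, |X i x|)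
    (ae_of_all _ fun x => Finset.sum_nonneg fun _ _ => abs_nonneg _)
    (integrable_finsetSum _ fun i _ => (hi i).abs) ((T : ℝ) ^ 2)
  have habs : ∀ i, ∫ x, |X i x| ∂μ = ∫ x, |X 0 x| ∂μ := fun i =>
    ((hident i).comp (u := fun z => |z|) (by fun_prop)).integral_eq
  rw [integral_finsetSum _ fun i _ => (hi i).abs] at hmarkov
  simp_rw [habs] at hmarkov
  rw [Finset.sum_const, Finset.card_range, nsmul_eq_mul] at hmarkov
  rw [le_div_iff₀ hTpos]
  have : (T : ℝ) * (μ.real {x | (T : ℝ) ^ 2 ≤ ∑ i ∈ Finset.range T, |X i x|} * T) ≤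
      T * ∫ x, |X 0 x| ∂μ := by
    calc _ = (T : ℝ) ^ 2 * μ.real {x | (T : ℝ) ^ 2 ≤ ∑ i ∈ Finset.range T, |X i x|} := by ring
      _ ≤ _ := hmarkov
  exact le_of_mul_le_mul_left this hTpos

/-! ### Least squares inequalities -/

theorem segmentSSR_le_sum_sq (y : ℕ → ℝ) (l m : ℕ) (β : ℝ) :
    segmentSSR y l m ≤ ∑ t ∈ Finset.Icc l m, (y t - β * y (t - 1)) ^ 2 := by
  set N := ∑ t ∈ Finset.Icc l m, y (t - 1) * y t with hN
  set D := ∑ t ∈ Finset.Icc l m, y (t - 1) ^ 2 with hD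
  have hexpand : ∀ γ : ℝ, ∑ t ∈ Finset.Icc l m, (y t - γ * y (t - 1)) ^ 2 =
      ∑ t ∈ Finset.Icc l m, y t ^ 2 - 2 * γ * N + γ ^ 2 * D := by
    intro γ
    rw [hN, hD, Finset.mul_sum, Finset.mul_sum, ← Finset.sum_sub_distrib, ← Finset.sum_add_distrib]
    exact Finset.sum_congr rfl fun t _ => by ring
  unfold segmentSSR
  have hcoef : arCoeff y l m = N / D := rfl
  by_cases hD0 : D = 0
  · have hz := (Finset.sum_eq_zero_iff_of_nonneg fun t _ => sq_nonneg (y (t - 1))).1 (hD ▸ hD0)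
    refine Finset.sum_le_sum fun t ht => ?_
    rw [pow_eq_zero_iff two_ne_zero |>.1 (hz t ht)]
    simp
  · have hDpos : 0 < D := lt_of_le_of_ne (Finset.sum_nonneg fun _ _ => sq_nonneg _) (Ne.symm hD0)
    rw [hexpand, hexpand, hcoef]
    have h : (-2 * β * N + β ^ 2 * D) - (-2 * (N / D) * N + (N / D) ^ 2 * D) =
        D * (β - N / D) ^ 2 := by
      field_simp
      ring
    have := mul_nonneg hDpos.le (sq_nonneg (β - N / D))
    linarith

/-- A regime boundary with different coefficients that lies inside one segment of the fit
contributes two residuals with a common coefficient. -/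
theorem exists_sq_add_sq_le_totalSSR (y : ℕ → ℝ) {T k j : ℕ} (hj : 1 ≤ j) (hjT : j < T)
    (hkj : k ≠ j) :
    ∃ γ, (y j - γ * y (j - 1)) ^ 2 + (y (j + 1) - γ * y j) ^ 2 ≤ totalSSR y T k := by
  have key : ∀ l m, l ≤ j → j + 1 ≤ m →
      (y j - arCoeff y l m * y (j - 1)) ^ 2 + (y (j + 1) - arCoeff y l m * y j) ^ 2 ≤
        segmentSSR y l m := by
    intro l m hl hm
    have hsub : ({j, j + 1} : Finset ℕ) ⊆ Finset.Icc l m := by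
      intro t ht
      simp only [Finset.mem_insert, Finset.mem_singleton] at ht
      rw [Finset.mem_Icc]
      omega
    have h := Finset.sum_le_sum_of_subset_of_nonneg hsub
      (f := fun t => (y t - arCoeff y l m * y (t - 1)) ^ 2) fun _ _ _ => sq_nonneg _
    rw [Finset.sum_pair (by omega)] at h
    unfold segmentSSR
    simpa using h
  have hnn : ∀ l m, 0 ≤ segmentSSR y l m := fun l m => Finset.sum_nonneg fun _ _ => sq_nonneg _
  unfold totalSSR
  rcases lt_or_gt_of_ne hkj with h | h
  · exact ⟨_, (key (k + 1) T (by omega) (by omega)).trans (le_add_of_nonneg_left (hnn _ _))⟩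
  · exact ⟨_, (key 1 k (by omega) (by omega)).trans (le_add_of_nonneg_right (hnn _ _))⟩

/-- A common coefficient cannot fit two consecutive observations of autoregressions with
coefficients `p` and `q`. -/
theorem le_abs_residual_or_le_abs_residual {u Y z p q e₁ e₂ B : ℝ}
    (hY : Y = p * u + e₁) (hz : z = q * Y + e₂) (he₁ : |e₁| ≤ B) (he₂ : |e₂| ≤ B)
    (hp₁ : 1 ≤ p) (hp₂ : p ≤ 2) (hBY : B ≤ |Y| / 2) (hYpos : 0 < |Y|) (hqp : q ≤ p) (γ : ℝ) :
    (p - q) * |Y| / 12 - B ≤ |Y - γ * u| ∨ (p - q) * |Y| / 12 - B ≤ |z - γ * Y| := by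
  by_contra! hcon
  obtain ⟨h1, h2⟩ := hcon
  have hB0 : 0 ≤ B := (abs_nonneg _).trans he₁
  have hpu : |p * u| = p * |u| := by rw [abs_mul, abs_of_nonneg (by linarith)]
  -- As `B ≤ |Y| / 2` and `1 ≤ p ≤ 2`, the values `u` and `Y` are of the same order.
  have hu_lo : |Y| / 4 ≤ |u| := by
    have : |Y| ≤ p * |u| + |e₁| := by rw [hY, ← hpu]; exact abs_add_le _ _
    nlinarith [abs_nonneg u]
  have hu_hi : |u| ≤ 2 * |Y| := by
    have : p * |u| ≤ |Y| + |e₁| := by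
      rw [← hpu, show p * u = Y - e₁ by linarith]; exact abs_sub _ _
    nlinarith [abs_nonneg u]
  set M := (p - q) * |Y| / 12 - B with hM
  have hMpos : 0 < M := (abs_nonneg _).trans_lt h1
  -- Weighting the residuals by `Y` and `u` eliminates `γ`.
  have hid : (p - q) * (Y * u) = (Y - γ * u) * Y - (z - γ * Y) * u - e₁ * Y + e₂ * u := by
    rw [hz]
    linear_combination -Y * hY
  have hlhs : |(p - q) * (Y * u)| = (p - q) * (|Y| * |u|) := by
    rw [abs_mul, abs_mul, abs_of_nonneg (by linarith)]
  have hrhs : |(Y - γ * u) * Y - (z - γ * Y) * u - e₁ * Y + e₂ * u| ≤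
      |Y - γ * u| * |Y| + |z - γ * Y| * |u| + |e₁| * |Y| + |e₂| * |u| := by
    simp only [← abs_mul]
    exact (abs_add_le _ _).trans (add_le_add_left ((abs_sub _ _).trans
      (add_le_add_left (abs_sub _ _) _)) _)
  rw [← hid, hlhs] at hrhs
  have a1 : |Y - γ * u| * |Y| < M * |Y| := mul_lt_mul_of_pos_right h1 hYpos
  have a2 : |z - γ * Y| * |u| ≤ M * (2 * |Y|) :=
    mul_le_mul h2.le hu_hi (abs_nonneg _) hMpos.le
  have a3 : |e₁| * |Y| ≤ B * |Y| := mul_le_mul_of_nonneg_right he₁ (abs_nonneg _)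
  have a4 : |e₂| * |u| ≤ B * (2 * |Y|) := mul_le_mul he₂ hu_hi (abs_nonneg _) hB0
  have a5 : (p - q) * (|Y| * (|Y| / 4)) ≤ (p - q) * (|Y| * |u|) := by
    have : 0 ≤ p - q := by linarith
    gcongr
  -- The upper bounds add up to less than `3 * (M + B) * |Y|`. The 12 in `M` is this 3 times the 4
  -- in `|Y| / 4 ≤ |u|`.
  have a6 : 3 * (M * |Y|) = (p - q) * (|Y| * (|Y| / 4)) - 3 * (B * |Y|) := by rw [hM]; ring
  linarith

/-! ### Deterministic analysis of a path -/

section Path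

variable {y ε : ℕ → ℝ} {T kₑ k_c k_r : ℕ} {d₀ d₁ p q : ℝ}

/-- Truncated subtraction makes the exponents `t - kₑ` and `i + 1 - kₑ` vanish up to the first
break, so one formula covers both regimes. -/
theorem path_eq_of_le_break (hp : p ≠ 0)
    (h₁ : ∀ t < kₑ, y (t + 1) = d₀ + y t + ε (t + 1))
    (h₂ : ∀ t, kₑ ≤ t → t < k_c → y (t + 1) = p * y t + ε (t + 1)) :
    ∀ t ≤ max kₑ k_c, y t = p ^ (t - kₑ) *
      (y 0 + (min t kₑ : ℕ) * d₀ + ∑ i ∈ Finset.range t, (p⁻¹) ^ (i + 1 - kₑ) * ε (i + 1)) := by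
  intro t
  induction t with
  | zero => intro _; simp
  | succ t ih =>
    intro ht
    have iht := ih (by omega)
    rw [Finset.sum_range_succ]
    rcases lt_or_ge t kₑ with h | h
    · rw [h₁ t h, iht]
      simp only [show t - kₑ = 0 by omega, show t + 1 - kₑ = 0 by omega,
        min_eq_left h.le, min_eq_left (Nat.succ_le_of_lt h), pow_zero, one_mul]
      push_cast
      ring
    · rw [h₂ t h (by omega), iht]
      simp only [show t + 1 - kₑ = (t - kₑ) + 1 by omega, min_eq_right h,
        min_eq_right (show kₑ ≤ t + 1 by omega)]
      have hinv : p ^ (t - kₑ + 1) * p⁻¹ ^ (t - kₑ + 1) = 1 := by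
        rw [← mul_pow, mul_inv_cancel₀ hp, one_pow]
      generalize p⁻¹ ^ (t - kₑ + 1) = z at *
      linear_combination -ε (t + 1) * hinv

theorem abs_path_le_of_le_first_break (hd₀ : 0 ≤ d₀)
    (h₁ : ∀ t < kₑ, y (t + 1) = d₀ + y t + ε (t + 1)) :
    ∀ t ≤ kₑ, |y t| ≤ |y 0| + t * d₀ + ∑ i ∈ Finset.range t, |ε (i + 1)| := by
  intro t
  induction t with
  | zero => intro _; simp
  | succ t ih =>
    intro ht
    rw [h₁ t (by omega), Finset.sum_range_succ]
    have h := ih (by omega)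
    have h' := abs_add_three d₀ (y t) (ε (t + 1))
    rw [abs_of_nonneg hd₀] at h'
    push_cast
    linarith

/-- The collapse contracts the peak geometrically, while shocks enter with weight at most 1. -/
theorem abs_path_le_of_break_le (hq₀ : 0 ≤ q) (hq₁ : q ≤ 1)
    (h₃ : ∀ t, k_c ≤ t → t < k_r → y (t + 1) = q * y t + ε (t + 1)) :
    ∀ t, k_c ≤ t → t ≤ k_r →
      |y t| ≤ q ^ (t - k_c) * |y k_c| + ∑ i ∈ Finset.range t, |ε (i + 1)| := by
  intro t ht
  induction t, ht using Nat.le_induction with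
  | base => intro _; simpa using Finset.sum_nonneg fun _ _ => abs_nonneg _
  | succ t ht ih =>
    intro htr
    rw [h₃ t ht (by omega), Finset.sum_range_succ, show t + 1 - k_c = t - k_c + 1 by omega]
    have h := ih (by omega)
    have h' := abs_add_le (q * y t) (ε (t + 1))
    rw [abs_mul, abs_of_nonneg hq₀] at h'
    have hs : 0 ≤ ∑ i ∈ Finset.range t, |ε (i + 1)| := Finset.sum_nonneg fun _ _ => abs_nonneg _
    have h'' := mul_le_mul_of_nonneg_left h hq₀
    have h3 := mul_le_of_le_one_left hs hq₁
    rw [pow_succ']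
    linarith

theorem abs_path_le_of_last_break_le {A : ℝ} (hd₁ : 0 ≤ d₁)
    (hA : |y k_r| ≤ A + ∑ i ∈ Finset.range k_r, |ε (i + 1)|)
    (h₄ : ∀ t, k_r ≤ t → y (t + 1) = d₁ + y t + ε (t + 1)) :
    ∀ t, k_r ≤ t → |y t| ≤ A + t * d₁ + ∑ i ∈ Finset.range t, |ε (i + 1)| := by
  intro t ht
  induction t, ht using Nat.le_induction with
  | base =>
    have : 0 ≤ (k_r : ℝ) * d₁ := by positivity
    linarith
  | succ t ht ih =>
    rw [h₄ t ht, Finset.sum_range_succ]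
    have h' := abs_add_three d₁ (y t) (ε (t + 1))
    rw [abs_of_nonneg hd₁] at h'
    push_cast
    linarith

theorem eq_break_of_isBreakDateEstimate {B D : ℝ} {k : ℕ}
    (hec : kₑ < k_c) (hcr : k_c < k_r) (hrT : k_r ≤ T)
    (hd₀ : 0 ≤ d₀) (hd₁ : 0 ≤ d₁) (hd₀D : d₀ ≤ D) (hd₁D : d₁ ≤ D)
    (hp₁ : 1 ≤ p) (hp₂ : p ≤ 2) (hq₀ : 0 ≤ q) (hq₁ : q ≤ 1)
    (h₁ : ∀ t < kₑ, y (t + 1) = d₀ + y t + ε (t + 1))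
    (h₂ : ∀ t, kₑ ≤ t → t < k_c → y (t + 1) = p * y t + ε (t + 1))
    (h₃ : ∀ t, k_c ≤ t → t < k_r → y (t + 1) = q * y t + ε (t + 1))
    (h₄ : ∀ t, k_r ≤ t → y (t + 1) = d₁ + y t + ε (t + 1))
    (hB : ∑ i ∈ Finset.range T, |ε (i + 1)| ≤ B)
    (hbig : T * ((T + 1) * D + 2 * B + |y 0| + q ^ (k_r - k_c) * |y k_c|) <
      (1 - q) * |y k_c| / 12 - B)
    (hk : IsBreakDateEstimate y T k) : k = k_c := by
  have hD0 : 0 ≤ D := hd₀.trans hd₀D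
  have hB0 : 0 ≤ B := (Finset.sum_nonneg fun _ _ => abs_nonneg _).trans hB
  have hT1 : (1 : ℝ) ≤ T := by exact_mod_cast (by omega : 1 ≤ T)
  have hpart : ∀ t ≤ T, ∑ i ∈ Finset.range t, |ε (i + 1)| ≤ B := fun t ht =>
    (Finset.sum_le_sum_of_subset_of_nonneg (Finset.range_mono ht)
      fun _ _ _ => abs_nonneg _).trans hB
  have hε : ∀ t < T, |ε (t + 1)| ≤ B := fun t ht =>
    (Finset.single_le_sum (f := fun i => |ε (i + 1)|) (fun _ _ => abs_nonneg _)
      (Finset.mem_range.2 ht)).trans hB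
  set A := q ^ (k_r - k_c) * |y k_c| with hA
  have hA0 : 0 ≤ A := by positivity
  set R := (T + 1) * D + 2 * B + |y 0| + A with hR
  have hR0 : 0 ≤ R := by positivity
  have hlate := abs_path_le_of_last_break_le hd₁
    (abs_path_le_of_break_le hq₀ hq₁ h₃ k_r hcr.le le_rfl) h₄
  have hearly := abs_path_le_of_le_first_break hd₀ h₁
  have htd : ∀ (t : ℕ) (d : ℝ), t ≤ T → 0 ≤ d → d ≤ D → (t : ℝ) * d ≤ T * D := fun t d ht h0 hd =>
    mul_le_mul (by exact_mod_cast ht) hd h0 (by positivity)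
  -- Up to `kₑ` the coefficient `p` is wrong by `p - 1 ≤ 1`, but the path has not yet exploded.
  have hresa : ∀ t < k_c, |y (t + 1) - p * y t| ≤ R := by
    intro t ht
    have he := hε t (by omega)
    rcases lt_or_ge t kₑ with h | h
    · rw [h₁ t h, show d₀ + y t + ε (t + 1) - p * y t = d₀ + (-(p - 1) * y t) + ε (t + 1) by ring]
      have h' := abs_add_three d₀ (-(p - 1) * y t) (ε (t + 1))
      rw [abs_mul, abs_neg, abs_of_nonneg hd₀, abs_of_nonneg (sub_nonneg.2 hp₁)] at h'
      have h'' := mul_le_of_le_one_left (abs_nonneg (y t)) (show p - 1 ≤ 1 by linarith)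
      have := hearly t h.le
      have := hpart t (by omega)
      have := htd t d₀ (by omega) hd₀ hd₀D
      linarith
    · rw [h₂ t h ht, add_sub_cancel_left]
      have : 0 ≤ (T + 1) * D := by positivity
      have := abs_nonneg (y 0)
      linarith
  -- After `k_r` the coefficient `q` is wrong by `1 - q ≤ 1`, but the peak has shrunk to `A`.
  have hresb : ∀ t, k_c ≤ t → t < T → |y (t + 1) - q * y t| ≤ R := by
    intro t ht htT
    have he := hε t htT
    rcases lt_or_ge t k_r with h | h
    · rw [h₃ t ht h, add_sub_cancel_left]
      have : 0 ≤ (T + 1) * D := by positivity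
      have := abs_nonneg (y 0)
      linarith
    · rw [h₄ t h, show d₁ + y t + ε (t + 1) - q * y t = d₁ + (1 - q) * y t + ε (t + 1) by ring]
      have h' := abs_add_three d₁ ((1 - q) * y t) (ε (t + 1))
      rw [abs_mul, abs_of_nonneg hd₁, abs_of_nonneg (sub_nonneg.2 hq₁)] at h'
      have h'' := mul_le_of_le_one_left (abs_nonneg (y t)) (show 1 - q ≤ 1 by linarith)
      have := hlate t h
      have := hpart t htT.le
      have := htd t d₁ htT.le hd₁ hd₁D
      have := abs_nonneg (y 0)
      linarith
  have hupper : totalSSR y T k_c ≤ T * R ^ 2 := by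
    have hsa : segmentSSR y 1 k_c ≤ k_c * R ^ 2 := by
      refine (segmentSSR_le_sum_sq y 1 k_c p).trans
        ((Finset.sum_le_card_nsmul _ _ (R ^ 2) fun t ht => ?_).trans (by simp))
      obtain ⟨s, rfl⟩ : ∃ s, t = s + 1 := ⟨t - 1, by grind⟩
      rw [← sq_abs, Nat.add_sub_cancel]
      exact pow_le_pow_left₀ (abs_nonneg _) (hresa s (by grind)) 2
    have hsb : segmentSSR y (k_c + 1) T ≤ (T - k_c : ℕ) * R ^ 2 := by
      refine (segmentSSR_le_sum_sq y (k_c + 1) T q).trans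
        ((Finset.sum_le_card_nsmul _ _ (R ^ 2) fun t ht => ?_).trans (by simp))
      obtain ⟨s, rfl⟩ : ∃ s, t = s + 1 := ⟨t - 1, by grind⟩
      rw [← sq_abs, Nat.add_sub_cancel]
      exact pow_le_pow_left₀ (abs_nonneg _) (hresb s (by grind) (by grind)) 2
    unfold totalSSR
    rw [Nat.cast_sub (by omega)] at hsb
    linarith
  by_contra hne
  obtain ⟨γ, hγ⟩ := exists_sq_add_sq_le_totalSSR y (T := T) (by omega) (by omega) hne
  set M := (1 - q) * |y k_c| / 12 - B with hM
  have hTR : T * R < M := hbig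
  have hMB : 0 < M := lt_of_le_of_lt (by positivity) hTR
  have hYB : B ≤ |y k_c| / 2 := by
    have := mul_le_of_le_one_left (abs_nonneg (y k_c)) (show 1 - q ≤ 1 by linarith)
    linarith [abs_nonneg (y k_c)]
  have hYpos : 0 < |y k_c| := by
    by_contra! h
    have h0 : |y k_c| = 0 := le_antisymm h (abs_nonneg _)
    rw [hM, h0] at hMB
    linarith
  have hstep : y k_c = p * y (k_c - 1) + ε (k_c - 1 + 1) := by
    have := h₂ (k_c - 1) (by omega) (by omega)
    rwa [Nat.sub_add_cancel (by omega)] at this ⊢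
  have hlow := le_abs_residual_or_le_abs_residual hstep (h₃ k_c le_rfl hcr)
    (hε _ (by omega)) (hε _ (by omega)) hp₁ hp₂ hYB hYpos (hq₁.trans hp₁) γ
  have hMle : M ≤ (p - q) * |y k_c| / 12 - B := by
    have := mul_le_mul_of_nonneg_right (show 1 - q ≤ p - q by linarith) (abs_nonneg (y k_c))
    linarith
  have hMsq : M ^ 2 ≤ totalSSR y T k := by
    rcases hlow with h | h
    · have := pow_le_pow_left₀ hMB.le (hMle.trans h) 2
      rw [sq_abs] at this
      linarith [sq_nonneg (y (k_c + 1) - γ * y k_c)]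
    · have := pow_le_pow_left₀ hMB.le (hMle.trans h) 2
      rw [sq_abs] at this
      linarith [sq_nonneg (y k_c - γ * y (k_c - 1))]
  have hmin := hk.2 k_c (Finset.mem_Icc.2 ⟨by omega, by omega⟩)
  have hlt : (T * R) ^ 2 < M ^ 2 := pow_lt_pow_left₀ hTR (by positivity) two_ne_zero
  -- Giving away a factor `T` allows `hbig` to compare sizes without square roots.
  have hle : T * R ^ 2 ≤ (T * R) ^ 2 := by
    rw [mul_pow]
    exact mul_le_mul_of_nonneg_right (by nlinarith) (sq_nonneg R)
  linarith

end Path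

/-! ### Growth rates and the bubble path for large samples -/

theorem bubblePath_succ (c₀ η₀ cₐ a c_b b c₁ η₁ : ℝ) (T kₑ k_c k_r : ℕ) (y₀ : ℝ) (ε : ℕ → ℝ)
    (t : ℕ) :
    bubblePath c₀ η₀ cₐ a c_b b c₁ η₁ T kₑ k_c k_r y₀ ε (t + 1) =
      if t + 1 ≤ kₑ then
        c₀ * (T : ℝ) ^ (-η₀) + bubblePath c₀ η₀ cₐ a c_b b c₁ η₁ T kₑ k_c k_r y₀ ε t + ε (t + 1)
      else if t + 1 ≤ k_c then
        (1 + cₐ / (T : ℝ) ^ a) * bubblePath c₀ η₀ cₐ a c_b b c₁ η₁ T kₑ k_c k_r y₀ ε t + ε (t + 1)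
      else if t + 1 ≤ k_r then
        (1 - c_b / (T : ℝ) ^ b) * bubblePath c₀ η₀ cₐ a c_b b c₁ η₁ T kₑ k_c k_r y₀ ε t + ε (t + 1)
      else
        c₁ * (T : ℝ) ^ (-η₁) + bubblePath c₀ η₀ cₐ a c_b b c₁ η₁ T kₑ k_c k_r y₀ ε t + ε (t + 1) :=
  rfl

theorem exists_eventually_add_mul_le {k l : ℕ → ℕ} {σ τ : ℝ}
    (hk : Tendsto (fun T : ℕ => (k T : ℝ) / T) atTop (𝓝 σ))
    (hl : Tendsto (fun T : ℕ => (l T : ℝ) / T) atTop (𝓝 τ)) (h : σ < τ) :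
    ∃ κ > 0, ∀ᶠ T : ℕ in atTop, (k T : ℝ) + κ * T ≤ l T := by
  refine ⟨(τ - σ) / 2, by linarith, ?_⟩
  filter_upwards [(hl.sub hk).eventually (lt_mem_nhds (show (τ - σ) / 2 < τ - σ by linarith)),
    eventually_gt_atTop 0] with T hT hT0
  have hTpos : (0 : ℝ) < T := by exact_mod_cast hT0
  rw [← sub_div, lt_div_iff₀ hTpos] at hT
  linarith

theorem tendsto_exp_mul_rpow_div_pow_atTop {c s : ℝ} (hc : 0 < c) (hs : 0 < s) (m : ℕ) :
    Tendsto (fun T : ℕ => Real.exp (c * (T : ℝ) ^ s) / (T : ℝ) ^ m) atTop atTop := by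
  have h := ((tendsto_exp_mul_div_rpow_atTop (m / s) c hc).comp (tendsto_rpow_atTop hs)).comp
    (tendsto_natCast_atTop_atTop (R := ℝ))
  refine h.congr fun T => ?_
  simp only [Function.comp_apply]
  rw [← Real.rpow_mul (Nat.cast_nonneg T), mul_div_cancel₀ _ hs.ne', Real.rpow_natCast]

theorem eventually_div_rpow_natCast_le_one (c : ℝ) {s : ℝ} (hs : 0 < s) :
    ∀ᶠ T : ℕ in atTop, c / (T : ℝ) ^ s ≤ 1 := by
  have h : Tendsto (fun T : ℕ => c / (T : ℝ) ^ s) atTop (𝓝 0) :=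
    ((tendsto_rpow_atTop hs).comp tendsto_natCast_atTop_atTop).const_div_atTop c
  exact h.eventually (ge_mem_nhds one_pos)

theorem mul_rpow_one_sub_le_mul_div {c s κ T n : ℝ} (hc : 0 < c) (hT : 0 < T) (hn : κ * T ≤ n) :
    κ * c * T ^ (1 - s) ≤ n * (c / T ^ s) := by
  rw [Real.rpow_sub hT, Real.rpow_one]
  calc κ * c * (T / T ^ s) = κ * T * (c / T ^ s) := by ring
    _ ≤ n * (c / T ^ s) := by gcongr

theorem exp_mul_div_two_le_one_add_pow {x : ℝ} (hx₀ : 0 ≤ x) (hx₁ : x ≤ 1) (n : ℕ) :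
    Real.exp (n * x / 2) ≤ (1 + x) ^ n := by
  -- The bound `|exp u - 1| ≤ 2 * |u|` at `u = x / 2` explains the halved exponent.
  have h := Real.abs_exp_sub_one_le (x := x / 2) (by rw [abs_of_nonneg] <;> linarith)
  rw [abs_of_nonneg (show 0 ≤ x / 2 by linarith)] at h
  have h' : Real.exp (x / 2) ≤ 1 + x := by linarith [le_abs_self (Real.exp (x / 2) - 1)]
  rw [mul_div_assoc, Real.exp_nat_mul]
  exact pow_le_pow_left₀ (Real.exp_nonneg _) h' n

theorem one_sub_pow_le_exp_neg_mul {x : ℝ} (hx₁ : x ≤ 1) (n : ℕ) :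
    (1 - x) ^ n ≤ Real.exp (-(n * x)) := by
  rw [← mul_neg, Real.exp_nat_mul]
  exact pow_le_pow_left₀ (by linarith) (Real.one_sub_le_exp_neg x) n

theorem eventually_mul_pow_lt_one_add_div_rpow_pow {c s κ : ℝ} (hc : 0 < c) (hs₀ : 0 < s)
    (hs₁ : s < 1) (hκ : 0 < κ) (C : ℝ) (m : ℕ) :
    ∀ᶠ T : ℕ in atTop, ∀ n : ℕ, κ * T ≤ n → C * (T : ℝ) ^ m < (1 + c / (T : ℝ) ^ s) ^ n := by
  filter_upwards [eventually_div_rpow_natCast_le_one c hs₀, eventually_gt_atTop 0,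
    (tendsto_exp_mul_rpow_div_pow_atTop (show 0 < κ * c / 2 by positivity)
      (sub_pos.2 hs₁) m).eventually_gt_atTop C] with T hx hT0 hC n hn
  have hT : (0 : ℝ) < T := by exact_mod_cast hT0
  rw [lt_div_iff₀ (by positivity)] at hC
  refine hC.trans_le (le_trans (Real.exp_le_exp.2 ?_)
    (exp_mul_div_two_le_one_add_pow (by positivity) hx n))
  have := mul_rpow_one_sub_le_mul_div (s := s) hc hT hn
  linarith

theorem eventually_pow_mul_one_sub_div_rpow_pow_lt {c s κ C : ℝ} (hc : 0 < c) (hs₀ : 0 < s)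
    (hs₁ : s < 1) (hκ : 0 < κ) (hC : 0 < C) (m : ℕ) :
    ∀ᶠ T : ℕ in atTop, ∀ n : ℕ, κ * T ≤ n → (T : ℝ) ^ m * (1 - c / (T : ℝ) ^ s) ^ n < C := by
  filter_upwards [eventually_div_rpow_natCast_le_one c hs₀, eventually_gt_atTop 0,
    (tendsto_exp_mul_rpow_div_pow_atTop (show 0 < κ * c by positivity)
      (sub_pos.2 hs₁) m).eventually_gt_atTop C⁻¹] with T hx hT0 hCT n hn
  have hT : (0 : ℝ) < T := by exact_mod_cast hT0
  rw [lt_div_iff₀ (by positivity), inv_mul_lt_iff₀ hC] at hCT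
  have h1 := mul_rpow_one_sub_le_mul_div (s := s) hc hT hn
  calc (T : ℝ) ^ m * (1 - c / (T : ℝ) ^ s) ^ n
      ≤ (T : ℝ) ^ m * Real.exp (-(κ * c * (T : ℝ) ^ (1 - s))) := by
        refine mul_le_mul_of_nonneg_left ((one_sub_pow_le_exp_neg_mul hx n).trans ?_) (by positivity)
        exact Real.exp_le_exp.2 (neg_le_neg h1)
    _ < C * Real.exp (κ * c * (T : ℝ) ^ (1 - s)) * Real.exp (-(κ * c * (T : ℝ) ^ (1 - s))) := by
        gcongr
    _ = C := by rw [mul_assoc, ← Real.exp_add, add_neg_cancel, Real.exp_zero, mul_one]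

/-- An exponent above `1 / 2` keeps the accumulated drift below the `√T` scale of the shocks. -/
theorem eventually_mul_rpow_neg_mul_le_mul_sqrt {c η δ : ℝ} (hη : 1 / 2 < η) (hδ : 0 < δ) :
    ∀ᶠ T : ℕ in atTop, T * (c * (T : ℝ) ^ (-η)) ≤ δ * √T := by
  have h : Tendsto (fun T : ℕ => c * (T : ℝ) ^ (-(η - 1 / 2))) atTop (𝓝 (c * 0)) :=
    ((tendsto_rpow_neg_atTop (sub_pos.2 hη)).comp tendsto_natCast_atTop_atTop).const_mul c
  rw [mul_zero] at h
  filter_upwards [h.eventually (ge_mem_nhds hδ), eventually_gt_atTop 0] with T hT hT0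
  have hTpos : (0 : ℝ) < T := by exact_mod_cast hT0
  calc T * (c * (T : ℝ) ^ (-η)) = c * (T : ℝ) ^ (-(η - 1 / 2)) * √T := by
        rw [Real.sqrt_eq_rpow, mul_assoc, ← Real.rpow_add hTpos, mul_left_comm]
        nth_rewrite 1 [← Real.rpow_one (T : ℝ)]
        rw [← Real.rpow_add hTpos]
        congr 2
        ring
    _ ≤ δ * √T := by gcongr

/-- Half of `d * Y / 12` absorbs the surviving peak `T * (ρ * Y)`, the other half the terms of order
`T ^ 3`. The loss of a factor `T` in `d ≥ c / T` accounts for `T ^ 4` and `T ^ 2 * ρ`. -/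
theorem mul_residual_bound_lt {T D H B δ c d ρ Y y₀ : ℝ} (hT : 1 ≤ T) (hD : 0 ≤ D) (hH : 0 ≤ H)
    (hδ : 0 < δ) (hc : 0 < c) (hB : B = H * T ^ 2) (hd : c / T ≤ d) (hy₀ : y₀ ≤ δ * T)
    (hρ : T ^ 2 * ρ ≤ c / 24) (hY : 24 * (2 * D + 3 * H + δ) / c * T ^ 4 < Y) :
    T * ((T + 1) * D + 2 * B + y₀ + ρ * Y) < d * Y / 12 - B := by
  have hTpos : 0 < T := by linarith
  have hYpos : 0 < Y := lt_of_le_of_lt (by positivity) hY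
  have hpoly : T * ((T + 1) * D + 2 * B + y₀) + B ≤ (2 * D + 3 * H + δ) * T ^ 3 := by
    have h2 : T ^ 2 ≤ T ^ 3 := pow_le_pow_right₀ hT (by norm_num)
    have h1 : T ≤ T ^ 3 := le_self_pow₀ hT (by norm_num)
    have e1 : T * y₀ ≤ δ * T ^ 2 := by nlinarith
    have e2 : δ * T ^ 2 ≤ δ * T ^ 3 := by gcongr
    have e3 : D * T ^ 2 ≤ D * T ^ 3 := by gcongr
    have e4 : D * T ≤ D * T ^ 3 := by gcongr
    have e5 : H * T ^ 2 ≤ H * T ^ 3 := by gcongr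
    rw [hB]
    nlinarith
  have hA : T * (ρ * Y) ≤ c / T * Y / 24 := by
    have : T * (ρ * Y) = T ^ 2 * ρ * (Y / T) := by field_simp
    rw [this]
    calc T ^ 2 * ρ * (Y / T) ≤ c / 24 * (Y / T) := by gcongr
      _ = _ := by ring
  have hK : (2 * D + 3 * H + δ) * T ^ 3 < c / T * Y / 24 := by
    calc (2 * D + 3 * H + δ) * T ^ 3
        = c / T * (24 * (2 * D + 3 * H + δ) / c * T ^ 4) / 24 := by field_simp
      _ < c / T * Y / 24 := by gcongr
  have hdY : c / T * Y ≤ d * Y := by gcongr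
  linarith

/-- On sample paths whose innovations are not too large in total, whose initial value is small and
whose discounted shocks do not cancel at the end of the explosive regime, the break is found. -/
theorem eventually_eq_break_of_isBreakDateEstimate_bubblePath
    {c₀ η₀ cₐ a c_b b c₁ η₁ : ℝ}
    (hc₀ : 0 ≤ c₀) (hη₀ : 1 / 2 < η₀) (hcₐ : 0 < cₐ) (ha₀ : 0 < a) (ha₁ : a < 1)
    (hc_b : 0 < c_b) (hb₀ : 0 < b) (hb₁ : b < 1) (hc₁ : 0 ≤ c₁) (hη₁ : 1 / 2 < η₁)
    {kₑ k_c k_r : ℕ → ℕ} {κ₁ κ₂ κ₃ δ H : ℝ} (hκ₁ : 0 < κ₁) (hκ₂ : 0 < κ₂) (hκ₃ : 0 < κ₃)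
    (h_ec : ∀ᶠ T : ℕ in atTop, (kₑ T : ℝ) + κ₁ * T ≤ k_c T)
    (h_cr : ∀ᶠ T : ℕ in atTop, (k_c T : ℝ) + κ₂ * T ≤ k_r T)
    (h_rT : ∀ᶠ T : ℕ in atTop, (k_r T : ℝ) + κ₃ * T ≤ T) (hδ : 0 < δ) (hH : 0 ≤ H) :
    ∀ᶠ T : ℕ in atTop, ∀ (y₀ : ℝ) (ε : ℕ → ℝ) (k : ℕ), |y₀| ≤ δ / 4 * √T →
      ∑ i ∈ Finset.range T, |ε (i + 1)| ≤ H * (T : ℝ) ^ 2 →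
      δ * √T ≤ |∑ i ∈ Finset.range (k_c T),
        ((1 + cₐ / (T : ℝ) ^ a)⁻¹) ^ (i + 1 - kₑ T) * ε (i + 1)| →
      IsBreakDateEstimate (bubblePath c₀ η₀ cₐ a c_b b c₁ η₁ T (kₑ T) (k_c T) (k_r T) y₀ ε) T k →
      k = k_c T := by
  filter_upwards [h_ec, h_cr, h_rT, eventually_gt_atTop 0,
    eventually_div_rpow_natCast_le_one cₐ ha₀, eventually_div_rpow_natCast_le_one c_b hb₀,
    eventually_mul_pow_lt_one_add_div_rpow_pow hcₐ ha₀ ha₁ hκ₁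
      (2 * (24 * (2 * (c₀ + c₁) + 3 * H + δ) / c_b) / δ) 4,
    eventually_pow_mul_one_sub_div_rpow_pow_lt hc_b hb₀ hb₁ hκ₂
      (show 0 < c_b / 24 by positivity) 2,
    eventually_mul_rpow_neg_mul_le_mul_sqrt (c := c₀) hη₀ (show 0 < δ / 4 by positivity)]
    with T hec hcr hrT hT0 hxa hxb hgrow hshrink hdrift y₀ ε k hy₀ hε hS hk
  have hT : (0 : ℝ) < T := by exact_mod_cast hT0
  have hT1 : (1 : ℝ) ≤ T := by exact_mod_cast hT0
  have hec' : kₑ T < k_c T := by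
    have : 0 < κ₁ * T := by positivity
    exact_mod_cast (show (kₑ T : ℝ) < k_c T by linarith)
  have hcr' : k_c T < k_r T := by
    have : 0 < κ₂ * T := by positivity
    exact_mod_cast (show (k_c T : ℝ) < k_r T by linarith)
  have hrT' : k_r T ≤ T := by
    have : 0 < κ₃ * T := by positivity
    exact_mod_cast (show (k_r T : ℝ) ≤ T by linarith)
  set y := bubblePath c₀ η₀ cₐ a c_b b c₁ η₁ T (kₑ T) (k_c T) (k_r T) y₀ ε with hy
  set p := 1 + cₐ / (T : ℝ) ^ a with hp
  set q := 1 - c_b / (T : ℝ) ^ b with hq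
  set d₀ := c₀ * (T : ℝ) ^ (-η₀) with hd₀
  set d₁ := c₁ * (T : ℝ) ^ (-η₁) with hd₁
  have hxa0 : 0 ≤ cₐ / (T : ℝ) ^ a := by positivity
  have hxb0 : 0 ≤ c_b / (T : ℝ) ^ b := by positivity
  have hd₀0 : 0 ≤ d₀ := by positivity
  have hd₁0 : 0 ≤ d₁ := by positivity
  have hd₀c : d₀ ≤ c₀ := mul_le_of_le_one_right hc₀
    (Real.rpow_le_one_of_one_le_of_nonpos hT1 (by linarith))
  have hd₁c : d₁ ≤ c₁ := mul_le_of_le_one_right hc₁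
    (Real.rpow_le_one_of_one_le_of_nonpos hT1 (by linarith))
  have h₁ : ∀ t < kₑ T, y (t + 1) = d₀ + y t + ε (t + 1) := fun t ht => by
    rw [hy, bubblePath_succ, if_pos (by omega)]
  have h₂ : ∀ t, kₑ T ≤ t → t < k_c T → y (t + 1) = p * y t + ε (t + 1) := fun t ht ht' => by
    rw [hy, bubblePath_succ, if_neg (by omega), if_pos (by omega)]
  have h₃ : ∀ t, k_c T ≤ t → t < k_r T → y (t + 1) = q * y t + ε (t + 1) := fun t ht ht' => by
    rw [hy, bubblePath_succ, if_neg (by omega), if_neg (by omega), if_pos (by omega)]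
  have h₄ : ∀ t, k_r T ≤ t → y (t + 1) = d₁ + y t + ε (t + 1) := fun t ht => by
    rw [hy, bubblePath_succ, if_neg (by omega), if_neg (by omega), if_neg (by omega)]
  have hy0 : y 0 = y₀ := rfl
  have hsqrt1 : 1 ≤ √(T : ℝ) := Real.one_le_sqrt.2 hT1
  have hsqrtT : √(T : ℝ) ≤ T := by
    rw [Real.sqrt_le_left hT.le]
    exact le_self_pow₀ hT1 two_ne_zero
  have hY : 24 * (2 * (c₀ + c₁) + 3 * H + δ) / c_b * (T : ℝ) ^ 4 < |y (k_c T)| := by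
    have hform := path_eq_of_le_break (p := p) (by positivity) h₁ h₂ (k_c T) (le_max_right _ _)
    rw [hform, min_eq_right hec'.le, hy0, abs_mul, abs_pow, abs_of_nonneg (by positivity : 0 ≤ p)]
    set S := ∑ i ∈ Finset.range (k_c T), p⁻¹ ^ (i + 1 - kₑ T) * ε (i + 1) with hSdef
    have hke : (kₑ T : ℝ) * d₀ ≤ δ / 4 * √T := by
      refine le_trans (mul_le_mul_of_nonneg_right ?_ hd₀0) hdrift
      exact_mod_cast (by omega : kₑ T ≤ T)
    have htri : |S| ≤ |y₀ + kₑ T * d₀ + S| + |y₀| + kₑ T * d₀ := by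
      have h := abs_sub (y₀ + kₑ T * d₀ + S) (y₀ + kₑ T * d₀)
      rw [add_sub_cancel_left] at h
      have h' := abs_add_le y₀ (kₑ T * d₀)
      rw [abs_of_nonneg (by positivity : 0 ≤ (kₑ T : ℝ) * d₀)] at h'
      linarith
    -- Initial value and drift each take at most a quarter of `δ * √T`, and `√T ≥ 1`.
    have hsum : δ / 2 ≤ |y₀ + kₑ T * d₀ + S| := by nlinarith
    have hgr := hgrow (k_c T - kₑ T) (by rw [Nat.cast_sub hec'.le]; linarith)
    calc 24 * (2 * (c₀ + c₁) + 3 * H + δ) / c_b * (T : ℝ) ^ 4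
        = 2 * (24 * (2 * (c₀ + c₁) + 3 * H + δ) / c_b) / δ * (T : ℝ) ^ 4 * (δ / 2) := by
          field_simp
      _ < p ^ (k_c T - kₑ T) * (δ / 2) := by gcongr
      _ ≤ p ^ (k_c T - kₑ T) * |y₀ + kₑ T * d₀ + S| := by gcongr
  have hρ := hshrink (k_r T - k_c T) (by rw [Nat.cast_sub hcr'.le]; linarith)
  refine eq_break_of_isBreakDateEstimate (D := c₀ + c₁) hec' hcr' hrT' hd₀0 hd₁0 (by linarith)
    (by linarith) (by linarith) (by linarith) (by linarith) (by linarith) h₁ h₂ h₃ h₄ hε ?_ hk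
  refine mul_residual_bound_lt hT1 (by positivity) hH hδ hc_b rfl ?_ ?_ hρ.le hY
  · rw [hq, sub_sub_cancel]
    gcongr
    exact Real.rpow_le_self_of_one_le hT1 hb₁.le
  · rw [hy0]
    nlinarith

/-! ### Convergence in probability -/

theorem theorem1 {Ω : Type*} [MeasurableSpace Ω] (μ : Measure Ω) [IsProbabilityMeasure μ]
    -- constants of the model
    (c₀ η₀ cₐ a c_b b c₁ η₁ : ℝ)
    (hc₀ : 0 ≤ c₀) (hη₀ : 1 / 2 < η₀)
    (hcₐ : 0 < cₐ) (ha₀ : 0 < a) (ha₁ : a < 1)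
    (hc_b : 0 < c_b) (hb₀ : 0 < b) (hb₁ : b < 1)
    (hc₁ : 0 ≤ c₁) (hη₁ : 1 / 2 < η₁)
    -- break dates, with distinct interior break fractions
    (kₑ k_c k_r : ℕ → ℕ) (τₑ τ_c τ_r : ℝ)
    (hkₑ : Tendsto (fun T : ℕ => (kₑ T : ℝ) / T) atTop (𝓝 τₑ))
    (hk_c : Tendsto (fun T : ℕ => (k_c T : ℝ) / T) atTop (𝓝 τ_c))
    (hk_r : Tendsto (fun T : ℕ => (k_r T : ℝ) / T) atTop (𝓝 τ_r))
    (hτₑ : 0 < τₑ) (hτₑ_c : τₑ < τ_c) (hτ_c_r : τ_c < τ_r) (hτ_r : τ_r < 1)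
    -- volatility function on the unit interval
    (w : ℝ → ℝ) (wlo whi : ℝ) (hwlo : 0 < wlo)
    (hw : ∀ s ∈ Set.Icc (0 : ℝ) 1, wlo < w s ∧ w s < whi)
    -- i.i.d. innovations e 1, e 2, … with mean 0, variance 1 and finite fourth moment
    (e : ℕ → Ω → ℝ)
    (he_indep : iIndepFun (fun t : ℕ => e (t + 1)) μ)
    (he_ident : ∀ t : ℕ, 1 ≤ t → IdentDistrib (e t) (e 1) μ μ)
    (he_four : MemLp (e 1) 4 μ)
    (he_mean : ∫ x, e 1 x ∂μ = 0) (he_var : ∫ x, e 1 x ^ 2 ∂μ = 1)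
    -- initial values of order o_p(T ^ (1 / 2))
    (y₀ : ℕ → Ω → ℝ) (hy₀_meas : ∀ T, AEMeasurable (y₀ T) μ)
    (hy₀ : TendstoInMeasure μ (fun (T : ℕ) x => y₀ T x / √(T : ℝ)) atTop (fun _ => 0))
    -- the observed process
    (y : ℕ → Ω → ℕ → ℝ)
    (hy : ∀ T x, y T x = bubblePath c₀ η₀ cₐ a c_b b c₁ η₁ T (kₑ T) (k_c T) (k_r T) (y₀ T x)
      (fun t => w ((t : ℝ) / T) * e t x))
    -- any minimizer of the total sum of squared residuals
    (khat : ℕ → Ω → ℕ)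
    (hkhat : ∀ T, 2 ≤ T → ∀ x, IsBreakDateEstimate (y T x) T (khat T x)) :
    Tendsto (fun T => μ {x | khat T x = k_c T}) atTop (𝓝 1) := by
  have hwhi : 0 < whi := hwlo.trans ((hw 0 (by simp)).1.trans (hw 0 (by simp)).2)
  have hident : ∀ i, IdentDistrib (e (i + 1)) (e (0 + 1)) μ μ := fun i => he_ident _ (by omega)
  have hzero : Tendsto (fun T : ℕ => (((fun _ => 0 : ℕ → ℕ) T : ℕ) : ℝ) / T) atTop (𝓝 0) := by simp
  have hone : Tendsto (fun T : ℕ => (((fun T => T : ℕ → ℕ) T : ℕ) : ℝ) / T) atTop (𝓝 1) := by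
    refine tendsto_const_nhds.congr' ?_
    filter_upwards [eventually_gt_atTop 0] with T hT
    have : (T : ℝ) ≠ 0 := by exact_mod_cast hT.ne'
    exact (div_self this).symm
  obtain ⟨κ₀, hκ₀, h_e⟩ := exists_eventually_add_mul_le hzero hkₑ hτₑ
  obtain ⟨κ₁, hκ₁, h_ec⟩ := exists_eventually_add_mul_le hkₑ hk_c hτₑ_c
  obtain ⟨κ₂, hκ₂, h_cr⟩ := exists_eventually_add_mul_le hk_c hk_r hτ_c_r
  obtain ⟨κ₃, hκ₃, h_rT⟩ := exists_eventually_add_mul_le hk_r hone hτ_r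
  suffices hreal : Tendsto (fun T => μ.real {x | khat T x = k_c T}) atTop (𝓝 1) by
    have := ENNReal.tendsto_ofReal hreal
    simpa using this
  refine tendsto_order.2 ⟨fun r hr => ?_, fun r hr =>
    Eventually.of_forall fun T => measureReal_le_one.trans_lt hr⟩
  -- Three exceptional events of this size cost less than `1 - r` in total.
  have hη : 0 < (1 - r) / 4 := by linarith
  obtain ⟨δ, hδ, hanti⟩ := exists_measureReal_abs_sum_le_sqrt_le he_indep hident he_mean he_var
    hwlo hwhi hκ₀ hη
  have he_int : Integrable (e (0 + 1)) μ := he_four.integrable (by norm_num)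
  have hsum : ∀ᶠ T : ℕ in atTop, (∫ x, |e (0 + 1) x| ∂μ) / T < (1 - r) / 4 :=
    (tendsto_const_div_atTop_nhds_zero_nat _).eventually (gt_mem_nhds hη)
  have hinit := ((tendstoInMeasure_iff_measureReal_norm.1 hy₀) (δ / 4) (by positivity)).eventually
    (gt_mem_nhds hη)
  filter_upwards [hanti, hsum, hinit, h_e, h_ec, h_cr, h_rT, eventually_ge_atTop 2,
    eventually_eq_break_of_isBreakDateEstimate_bubblePath hc₀ hη₀ hcₐ ha₀ ha₁ hc_b hb₀ hb₁ hc₁ hη₁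
      hκ₁ hκ₂ hκ₃ h_ec h_cr h_rT hδ hwhi.le]
    with T hanti hsum hinit he hec hcr hrT hT2 hfind
  have hT0 : 0 < T := by omega
  have hT : (0 : ℝ) < T := by exact_mod_cast hT0
  have hec' : kₑ T ≤ k_c T := by
    have : 0 < κ₁ * T := by positivity
    exact_mod_cast (show (kₑ T : ℝ) ≤ k_c T by linarith)
  have heT : kₑ T ≤ T := by
    have : 0 < κ₁ * T + κ₂ * T + κ₃ * T := by positivity
    exact_mod_cast (show (kₑ T : ℝ) ≤ T by linarith)
  have hw' : ∀ i < T, wlo < w (((i + 1 : ℕ) : ℝ) / T) ∧ w (((i + 1 : ℕ) : ℝ) / T) < whi := by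
    intro i hi
    refine hw _ ⟨by positivity, (div_le_one hT).2 ?_⟩
    exact_mod_cast hi
  set v : ℕ → ℝ := fun i =>
    ((1 + cₐ / (T : ℝ) ^ a)⁻¹) ^ (i + 1 - kₑ T) * w (((i + 1 : ℕ) : ℝ) / T) with hv
  -- The shocks up to `kₑ` are undiscounted, so their weights lie between the volatility bounds.
  have hcancel := hanti (kₑ T) (k_c T) v (by simpa using he) hec' fun i hi => by
    have := hw' i (by omega)
    simp only [hv, show i + 1 - kₑ T = 0 by omega, pow_zero, one_mul]
    exact ⟨this.1.le, this.2.le⟩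
  have hlarge := measureReal_sq_le_sum_abs_le hident he_int hT0
  set E₁ := {x | |∑ i ∈ Finset.range (k_c T), v i * e (i + 1) x| ≤ δ * √(T : ℝ)} with hE₁
  set E₂ := {x | (T : ℝ) ^ 2 ≤ ∑ i ∈ Finset.range T, |e (i + 1) x|} with hE₂
  set E₃ := {x | δ / 4 ≤ ‖y₀ T x / √(T : ℝ) - 0‖} with hE₃
  -- `khat` need not be measurable. A cover uses only monotonicity and subadditivity, which hold for
  -- arbitrary sets.
  have hcover : Set.univ ⊆ {x | khat T x = k_c T} ∪ (E₁ ∪ (E₂ ∪ E₃)) := by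
    intro x _
    by_contra! hx
    simp only [Set.mem_union, not_or, hE₁, hE₂, hE₃, Set.mem_ofPred_eq, not_le] at hx
    obtain ⟨hne, hx₁, hx₂, hx₃⟩ := hx
    refine hne (hfind (y₀ T x) (fun t => w ((t : ℝ) / T) * e t x) _ ?_ ?_ ?_
      (hy T x ▸ hkhat T hT2 x))
    · rw [sub_zero, norm_div, Real.norm_eq_abs, Real.norm_of_nonneg (Real.sqrt_nonneg _),
        div_lt_iff₀ (Real.sqrt_pos.2 hT)] at hx₃
      exact hx₃.le
    · calc ∑ i ∈ Finset.range T, |w (((i + 1 : ℕ) : ℝ) / T) * e (i + 1) x|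
          ≤ ∑ i ∈ Finset.range T, whi * |e (i + 1) x| := by
            refine Finset.sum_le_sum fun i hi => ?_
            obtain ⟨h1, h2⟩ := hw' i (Finset.mem_range.1 hi)
            rw [abs_mul, abs_of_pos (hwlo.trans h1)]
            gcongr
        _ ≤ whi * (T : ℝ) ^ 2 := by
            rw [← Finset.mul_sum]
            gcongr
    · refine hx₁.le.trans_eq ?_
      simp only [hv, mul_assoc]
  have huniv : (1 : ℝ) ≤ μ.real {x | khat T x = k_c T} +
      (μ.real E₁ + (μ.real E₂ + μ.real E₃)) := by
    calc (1 : ℝ) = μ.real Set.univ := probReal_univ.symm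
      _ ≤ μ.real ({x | khat T x = k_c T} ∪ (E₁ ∪ (E₂ ∪ E₃))) := measureReal_mono hcover
      _ ≤ _ := (measureReal_union_le _ _).trans (add_le_add_right
          ((measureReal_union_le _ _).trans (add_le_add_right (measureReal_union_le _ _) _)) _)
  linarith
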